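/- **Setting.** All alphabets are finite. Let $(X_1,Y_1,Z_1)$ and $(X_2,Y_2,Z_2)$ be independent triples of correlated sources that are degraded in mismatched order, i.e. $X_1 - Y_1 - Z_1$ and $X_2 - Z_2 - Y_2$ are Markov chains, and let $(X^n,Y^n,Z^n)$ be i.i.d. copies of $(X,Y,Z)=((X_1,X_2),(Y_1,Y_2),(Z_1,Z_2))$. For $i=1,2$ let $\hat d_i:\mathcal X_i\times\hat{\mathcal X}_i\to[0,\infty)$ and $\tilde d_i:\mathcal X_i\times\tilde{\mathcal X}_i\to[0,\infty)$ be distortion measures for which distortion $0$ means exact reproduction: every source symbol has a reproduction symbol at distortion $0$, and no reproduction symbol is at distortion $0$ from two distinct source symbols (for example, the Hamming distortion). A code of block length $n$ consists of an encoder $\varphi_n:\mathcal X^n\to\{1,\dots,M_n\}$ and two decoders $\phi_n:\{1,\dots,M_n\}\times\mathcal Y^n\to\hat{\mathcal X}_1^n\times\hat{\mathcal X}_2^n$ and $\psi_n:\{1,\dots,M_n\}\times\mathcal Z^n\to\tilde{\mathcal X}_1^n\times\tilde{\mathcal X}_2^n$; put $(\hat X_1^n,\hat X_2^n)=\phi_n(\varphi_n(X^n),Y^n)$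 and $(\tilde X_1^n,\tilde X_2^n)=\psi_n(\varphi_n(X^n),Z^n)$. A rate $R$ is $\mathbf 0$-achievable if for every $\gamma>0$ there is a sequence of codes such that, for all sufficiently large $n$, $\frac1n\log M_n\le R+\gamma$ and, for $i=1,2$, $\frac1n\sum_{t=1}^n\mathbb E[\hat d_i(X_{it},\hat X_{it})]\le\gamma$ and $\frac1n\sum_{t=1}^n\mathbb E[\tilde d_i(X_{it},\tilde X_{it})]\le\gamma$. Let $R(\mathbf 0)$ be the infimum of the $\mathbf 0$-achievable rates. Let $R_i(0,0)$ be the rate-distortion function at distortion levels $(0,0)$ of the single source $(X_i,Y_i,Z_i)$ with the two distortion measures $\hat d_i$ (decoder with $Y_i$) and $\tilde d_i$ (decoder with $Z_i$), defined in the same way. Logarithms and entropies are taken to the same base. **Corollary.** (a) The set of $\mathbf 0$-achievable rates is non-empty and bounded below, and $$R(\mathbf 0)=\max\{H(X_1|Y_1)+H(X_2|Y_2),\ H(X_1|Z_1)+H(X_2|Z_2)\}.$$ (b) This can be strictly smaller than the sum of the component-wise optima: there are binary sources $(X_1,Y_1,Z_1)$, $(X_2,Y_2,Z_2)$, degraded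 in mismatched order, for which $$\max\{H(X_1|Y_1)+H(X_2|Y_2),\,H(X_1|Z_1)+H(X_2|Z_2)\}<\max\{H(X_1|Y_1),H(X_1|Z_1)\}+\max\{H(X_2|Y_2),H(X_2|Z_2)\}$$ and, for all distortion measures as above, $R(\mathbf 0)<R_1(0,0)+R_2(0,0)$. -/

import Mathlib

open scoped NNReal

namespace SideInfo

noncomputable section

/-- The conditional entropy `H(A | B)` (in nats) of a pair `(A, B)` with joint law `Q`:
the average over `b` of the entropy of the conditional law of `A` given `B = b`. -/
def condEntropy {A B : Type*} [Fintype A] [Fintype B] (Q : PMF (A × B)) : ℝ :=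
  ∑ b, (Q.map Prod.snd b).toReal *
    ∑ a, Real.negMulLog ((Q (a, b)).toReal / (Q.map Prod.snd b).toReal)

/-- `A`, `B`, `C` with joint law `Q` form a Markov chain in this order, that is, `A` and `C` are
conditionally independent given `B`. -/
def IsMarkovChain {A B C : Type*} (Q : PMF (A × B × C)) : Prop :=
  ∀ a b c, Q (a, b, c) * Q.map (fun w => w.2.1) b =
    Q.map (fun w => (w.1, w.2.1)) (a, b) * Q.map Prod.snd (b, c)

/-- For a source `(X, Y, Z)`: the law of `(X, Y)`. -/
def lawXY {X Y Z : Type*} (P : PMF (X × Y × Z)) : PMF (X × Y) :=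
  P.map fun w => (w.1, w.2.1)

/-- For a source `(X, Y, Z)`: the law of `(X, Z)`. -/
def lawXZ {X Y Z : Type*} (P : PMF (X × Y × Z)) : PMF (X × Z) :=
  P.map fun w => (w.1, w.2.2)

/-- For a source `(X, Y, Z)`: the law of `(X, Z, Y)`. -/
def lawXZY {X Y Z : Type*} (P : PMF (X × Y × Z)) : PMF (X × Z × Y) :=
  P.map fun w => (w.1, w.2.2, w.2.1)

/-- The components are degraded in mismatched order: `X₁ → Y₁ → Z₁` and `X₂ → Z₂ → Y₂` are
Markov chains. -/
def MismatchedDegraded {X₁ Y₁ Z₁ X₂ Y₂ Z₂ : Type*}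
    (P₁ : PMF (X₁ × Y₁ × Z₁)) (P₂ : PMF (X₂ × Y₂ × Z₂)) : Prop :=
  IsMarkovChain P₁ ∧ IsMarkovChain (lawXZY P₂)

/-- The law of `((X₁, X₂), (Y₁, Y₂), (Z₁, Z₂))` where `(X₁, Y₁, Z₁)` has law `P₁`,
`(X₂, Y₂, Z₂)` has law `P₂`, and the two triples are independent. -/
def productSource {X₁ Y₁ Z₁ X₂ Y₂ Z₂ : Type*}
    (P₁ : PMF (X₁ × Y₁ × Z₁)) (P₂ : PMF (X₂ × Y₂ × Z₂)) :
    PMF ((X₁ × X₂) × (Y₁ × Y₂) × (Z₁ × Z₂)) :=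
  P₁.bind fun u => P₂.map fun v => ((u.1, v.1), (u.2.1, v.2.1), (u.2.2, v.2.2))

/-- The expectation of `f (A_1, …, A_n)` where `A_1, …, A_n` are i.i.d. with law `P`. -/
def iidExpect {A : Type*} [Fintype A] (P : PMF A) (n : ℕ) (f : (Fin n → A) → ℝ) : ℝ :=
  ∑ w : Fin n → A, (∏ t, (P (w t)).toReal) * f w

/-- A code of block length `n` with one encoder, which sees `X^n`, and two decoders, which see the
message and `Y^n`, respectively `Z^n`. The reproduction alphabets are `Xh` and `Xt`. -/
structure Code (X Y Z Xh Xt : Type*) (n : ℕ) where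
  M : ℕ
  enc : (Fin n → X) → Fin M
  dec₁ : Fin M → (Fin n → Y) → (Fin n → Xh)
  dec₂ : Fin M → (Fin n → Z) → (Fin n → Xt)

section

variable {X Y Z Xh Xt : Type*} [Fintype X] [Fintype Y] [Fintype Z]

/-- `(1/n) ∑ₜ E[d(X_t, X̂_t)]` for the first decoder. -/
def Code.distortion₁ {n : ℕ} (c : Code X Y Z Xh Xt n) (P : PMF (X × Y × Z))
    (d : X → Xh → ℝ≥0) : ℝ :=
  (1 / (n : ℝ)) * ∑ t : Fin n, iidExpect P n fun w =>
    (d (w t).1 (c.dec₁ (c.enc fun s => (w s).1) (fun s => (w s).2.1) t) : ℝ)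

/-- `(1/n) ∑ₜ E[d(X_t, X̃_t)]` for the second decoder. -/
def Code.distortion₂ {n : ℕ} (c : Code X Y Z Xh Xt n) (P : PMF (X × Y × Z))
    (d : X → Xt → ℝ≥0) : ℝ :=
  (1 / (n : ℝ)) * ∑ t : Fin n, iidExpect P n fun w =>
    (d (w t).1 (c.dec₂ (c.enc fun s => (w s).1) (fun s => (w s).2.2) t) : ℝ)

/-- The rate `R` is achievable at distortion levels `Dh`, `Dt`. There may be several distortion
criteria per decoder, indexed by `ι`: two (one per component) for a product source, one for a
component source on its own. -/
def Achievable {ι : Type*} (P : PMF (X × Y × Z))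
    (dh : ι → X → Xh → ℝ≥0) (dt : ι → X → Xt → ℝ≥0) (Dh Dt : ι → ℝ) (R : ℝ) : Prop :=
  ∀ γ : ℝ, 0 < γ → ∃ c : (n : ℕ) → Code X Y Z Xh Xt n, ∀ᶠ n : ℕ in Filter.atTop,
    (1 / (n : ℝ)) * Real.log ((c n).M : ℝ) ≤ R + γ ∧
    ∀ i, (c n).distortion₁ P (dh i) ≤ Dh i + γ ∧ (c n).distortion₂ P (dt i) ≤ Dt i + γ

/-- The set of achievable rates. -/
def achievableRates {ι : Type*} (P : PMF (X × Y × Z))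
    (dh : ι → X → Xh → ℝ≥0) (dt : ι → X → Xt → ℝ≥0) (Dh Dt : ι → ℝ) : Set ℝ :=
  {R | Achievable P dh dt Dh Dt R}

/-- The rate-distortion function. -/
def rateDistortion {ι : Type*} (P : PMF (X × Y × Z))
    (dh : ι → X → Xh → ℝ≥0) (dt : ι → X → Xt → ℝ≥0) (Dh Dt : ι → ℝ) : ℝ :=
  sInf (achievableRates P dh dt Dh Dt)

/-- The rate-distortion function of a single source with one distortion measure per decoder. -/
def componentRD (P : PMF (X × Y × Z)) (dh : X → Xh → ℝ≥0) (dt : X → Xt → ℝ≥0)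
    (Dh Dt : ℝ) : ℝ :=
  rateDistortion (ι := Unit) P (fun _ => dh) (fun _ => dt) (fun _ => Dh) (fun _ => Dt)

end

/-- The two distortion measures, one per component, of a product source. -/
def productDistortion {X₁ X₂ V₁ V₂ : Type*} (d₁ : X₁ → V₁ → ℝ≥0) (d₂ : X₂ → V₂ → ℝ≥0) :
    Fin 2 → X₁ × X₂ → V₁ × V₂ → ℝ≥0 :=
  ![fun x v => d₁ x.1 v.1, fun x v => d₂ x.2 v.2]

section

variable {X₁ Y₁ Z₁ X₂ Y₂ Z₂ Xh₁ Xh₂ Xt₁ Xt₂ : Type*}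
  [Fintype X₁] [Fintype Y₁] [Fintype Z₁] [Fintype X₂] [Fintype Y₂] [Fintype Z₂]

/-- The set of rates that are achievable for the product source at distortion levels
`(Dh 0, Dh 1, Dt 0, Dt 1)`. -/
def productRates (P₁ : PMF (X₁ × Y₁ × Z₁)) (P₂ : PMF (X₂ × Y₂ × Z₂))
    (dh₁ : X₁ → Xh₁ → ℝ≥0) (dh₂ : X₂ → Xh₂ → ℝ≥0)
    (dt₁ : X₁ → Xt₁ → ℝ≥0) (dt₂ : X₂ → Xt₂ → ℝ≥0) (Dh Dt : Fin 2 → ℝ) : Set ℝ :=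
  achievableRates (productSource P₁ P₂)
    (productDistortion dh₁ dh₂) (productDistortion dt₁ dt₂) Dh Dt

/-- The rate-distortion function of the product source. -/
def productRD (P₁ : PMF (X₁ × Y₁ × Z₁)) (P₂ : PMF (X₂ × Y₂ × Z₂))
    (dh₁ : X₁ → Xh₁ → ℝ≥0) (dh₂ : X₂ → Xh₂ → ℝ≥0)
    (dt₁ : X₁ → Xt₁ → ℝ≥0) (dt₂ : X₂ → Xt₂ → ℝ≥0) (Dh Dt : Fin 2 → ℝ) : ℝ :=
  rateDistortion (productSource P₁ P₂)
    (productDistortion dh₁ dh₂) (productDistortion dt₁ dt₂) Dh Dt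

end

/-- Zero distortion is possible for every source symbol and means exact reproduction: each source
symbol has a reproduction symbol at distortion `0`, and no reproduction symbol is at distortion
`0` from two distinct source symbols. The Hamming distortion is the basic example. -/
def ZeroMeansExact {X V : Type*} (d : X → V → ℝ≥0) : Prop :=
  (∀ x, ∃ v, d x v = 0) ∧ ∀ x x' v, d x v = 0 → d x' v = 0 → x = x'

end

end SideInfo

/-!
At distortion zero both decoders have to reproduce the source, so the problem is lossless coding of
`X` for one decoder which knows `Y` and another which knows `Z`. For an arbitrary source the
achievable rates are exactly those `≥ max (H(X|Y)) (H(X|Z))` (`achievableRates_zero_eq_Ici`). The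
product formula follows because conditional entropy is additive over independent pairs
(`condEntropy_prod`).

*Converse.* A code with small mean distortion yields a description of the source given the side
information: weight each message by `1 / M` and, given the message, the source sequence `x` by the
product of `exp (-s * D (x_t, v_t)) / C`, where `v` is the reproduction and `C` bounds the partition
functions. By Gibbs' inequality (`iidExpect_log_le`) the mean code length
`log M + n * log C + s * ∑ E[D]` is at least `n * H(X|Y)` (`condEntropy_le_of_code`). Since no
reproduction symbol is at distortion `0` from two source symbols, `C` tends to `1` as `s` grows; let
the distortion tend to `0` first and then `s` to infinity.

*Achievability.* Assign the source sequences to bins at random, and let each decoder look in the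
announced bin for a sequence of conditional probability at least `exp (-n * a)`. At most
`exp (n * a)` sequences are that likely, so a second one in the same bin is improbable once the rate
exceeds `a`; and if `a` exceeds the conditional entropy, a Chernoff bound
(`tendsto_iidExpect_exceed`) shows that the true sequence is likely enough. Averaging the sum of the
two failure probabilities over all bin assignments gives one assignment that serves both decoders
(`eventually_exists_binning`).

*The gap.* If a source has `H(X|Y) < H(X|Z)` and a second one is the same with the roles of `Y` and
`Z` exchanged, both entries of the maximum are `H(X|Y) + H(X|Z)`, while the separate codes need
`2 * H(X|Z)`. The source `bitCascade` realizes this with all three variables nonconstant.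
-/

namespace SideInfo

open Filter Topology

/-! ### Finite laws and i.i.d. expectations -/

section Iid

variable {A B : Type*} [Fintype A]

theorem sum_toReal (P : PMF A) : ∑ a, (P a).toReal = 1 := by
  rw [← ENNReal.toReal_sum fun a _ => P.apply_ne_top a]
  have := P.tsum_coe
  rw [tsum_fintype] at this
  simp [this]

open Classical in
theorem map_toReal (P : PMF A) (f : A → B) (b : B) :
    (P.map f b).toReal = ∑ a, if f a = b then (P a).toReal else 0 := by
  rw [PMF.map_apply, tsum_fintype, ENNReal.toReal_sum]
  · refine Finset.sum_congr rfl fun a _ => ?_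
    by_cases h : f a = b
    · simp [h]
    · simp [h, Ne.symm h]
  · intro a _
    split_ifs
    · exact P.apply_ne_top a
    · simp

omit [Fintype A] in
theorem prod_toReal_nonneg (P : PMF A) {n : ℕ} (w : Fin n → A) :
    0 ≤ ∏ t, (P (w t)).toReal :=
  Finset.prod_nonneg fun _ _ => ENNReal.toReal_nonneg

theorem iidExpect_prod (P : PMF A) {n : ℕ} (g : Fin n → A → ℝ) :
    iidExpect P n (fun w => ∏ t, g t (w t)) = ∏ t, ∑ a, (P a).toReal * g t a := by
  rw [Fintype.prod_sum]
  simp only [iidExpect, Finset.prod_mul_distrib]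

theorem iidExpect_const (P : PMF A) (n : ℕ) (c : ℝ) : iidExpect P n (fun _ => c) = c := by
  have h := iidExpect_prod P (n := n) fun _ _ => 1
  simp only [iidExpect, Finset.prod_const_one, mul_one, sum_toReal] at h
  simp [iidExpect, ← Finset.sum_mul, h]

theorem iidExpect_coord (P : PMF A) {n : ℕ} (t : Fin n) (g : A → ℝ) :
    iidExpect P n (fun w => g (w t)) = ∑ a, (P a).toReal * g a := by
  have h := iidExpect_prod P (n := n) fun s a => if s = t then g a else 1
  have h2 : ∀ s : Fin n, ∑ a, (P a).toReal * (if s = t then g a else 1) =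
      if s = t then ∑ a, (P a).toReal * g a else 1 := by
    intro s
    split_ifs
    · rfl
    · simp [sum_toReal]
  simp only [h2] at h
  simpa using h

theorem iidExpect_add (P : PMF A) {n : ℕ} (f g : (Fin n → A) → ℝ) :
    iidExpect P n (fun w => f w + g w) = iidExpect P n f + iidExpect P n g := by
  simp [iidExpect, mul_add, Finset.sum_add_distrib]

theorem iidExpect_const_mul (P : PMF A) {n : ℕ} (c : ℝ) (f : (Fin n → A) → ℝ) :
    iidExpect P n (fun w => c * f w) = c * iidExpect P n f := by
  simp only [iidExpect, Finset.mul_sum]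
  exact Finset.sum_congr rfl fun w _ => by ring

theorem iidExpect_sum {ι : Type*} (s : Finset ι) (P : PMF A) {n : ℕ}
    (f : ι → (Fin n → A) → ℝ) :
    iidExpect P n (fun w => ∑ i ∈ s, f i w) = ∑ i ∈ s, iidExpect P n (f i) := by
  simp only [iidExpect, Finset.mul_sum]
  exact Finset.sum_comm

/-- An inequality need only be checked on sequences of positive probability. -/
theorem iidExpect_mono (P : PMF A) {n : ℕ} {f g : (Fin n → A) → ℝ}
    (h : ∀ w, (∀ t, P (w t) ≠ 0) → f w ≤ g w) : iidExpect P n f ≤ iidExpect P n g := by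
  refine Finset.sum_le_sum fun w _ => ?_
  by_cases hw : ∀ t, P (w t) ≠ 0
  · exact mul_le_mul_of_nonneg_left (h w hw) (prod_toReal_nonneg P w)
  · push Not at hw
    obtain ⟨t, ht⟩ := hw
    have : ∏ t, (P (w t)).toReal = 0 := Finset.prod_eq_zero (Finset.mem_univ t) (by simp [ht])
    simp [this]

/-- Change of variables: coordinatewise functions of an i.i.d. sequence are i.i.d. -/
theorem iidExpect_map [Fintype B] (P : PMF A) (φ : A → B) {n : ℕ} (f : (Fin n → B) → ℝ) :
    iidExpect (P.map φ) n f = iidExpect P n fun u => f fun t => φ (u t) := by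
  classical
  have key : ∀ w : Fin n → B, ∏ t, (P.map φ (w t)).toReal =
      ∑ u : Fin n → A, if (fun t => φ (u t)) = w then ∏ t, (P (u t)).toReal else 0 := by
    intro w
    simp only [map_toReal]
    rw [Fintype.prod_sum]
    refine Finset.sum_congr rfl fun u _ => ?_
    split_ifs with h
    · exact Finset.prod_congr rfl fun t _ => by simp [← h]
    · obtain ⟨t, ht⟩ := Function.ne_iff.1 h
      exact Finset.prod_eq_zero (Finset.mem_univ t) (by simp [ht])
  simp only [iidExpect, key, Finset.sum_mul]
  rw [Finset.sum_comm]
  refine Finset.sum_congr rfl fun u _ => ?_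
  simp

/-- **Chernoff bound**: the empirical mean of `g` exceeds a level above its expectation with
vanishing probability. -/
theorem tendsto_iidExpect_exceed (P : PMF A) (g : A → ℝ) {a : ℝ}
    (h : ∑ x, (P x).toReal * g x < a) :
    Tendsto (fun n : ℕ => iidExpect P n fun w => if n * a < ∑ t, g (w t) then 1 else 0)
      atTop (𝓝 0) := by
  -- The moment generating function of `g - a` is `1` at `0` and has negative derivative there.
  obtain ⟨s, hs, hr⟩ : ∃ s : ℝ, 0 < s ∧ ∑ x, (P x).toReal * Real.exp (s * (g x - a)) < 1 := by
    have hd : HasDerivAt (fun s : ℝ => ∑ x, (P x).toReal * Real.exp (s * (g x - a)))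
        (∑ x, (P x).toReal * (g x - a)) 0 := by
      refine HasDerivAt.fun_sum fun x _ => ?_
      have := (((hasDerivAt_id (0 : ℝ)).mul_const (g x - a)).exp).const_mul (P x).toReal
      simpa using this
    have hneg : ∑ x, (P x).toReal * (g x - a) < 0 := by
      simp only [mul_sub, Finset.sum_sub_distrib, ← Finset.sum_mul, sum_toReal]
      linarith
    have hslope := hd.tendsto_slope_zero_right.eventually_lt_const hneg
    obtain ⟨s, hs1, hs2⟩ := (hslope.and self_mem_nhdsWithin).exists
    have hs2 : 0 < s := hs2
    refine ⟨s, hs2, ?_⟩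
    simp only [zero_add, zero_mul, Real.exp_zero, mul_one, sum_toReal, smul_eq_mul] at hs1
    have := (inv_mul_lt_iff₀ hs2).1 hs1
    linarith
  have hr0 : 0 ≤ ∑ x, (P x).toReal * Real.exp (s * (g x - a)) :=
    Finset.sum_nonneg fun x _ => by positivity
  refine squeeze_zero (fun n => ?_) (fun n => ?_) (tendsto_pow_atTop_nhds_zero_of_lt_one hr0 hr)
  · refine Finset.sum_nonneg fun w _ => mul_nonneg (prod_toReal_nonneg P w) ?_
    dsimp only
    split_ifs <;> norm_num
  · have h1 := iidExpect_prod P (n := n) fun _ x => Real.exp (s * (g x - a))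
    simp only [Finset.prod_const, Finset.card_univ, Fintype.card_fin] at h1
    rw [← h1]
    refine iidExpect_mono P fun w _ => ?_
    rw [← Real.exp_sum, ← Finset.mul_sum, Finset.sum_sub_distrib]
    split_ifs with hw
    · refine Real.one_le_exp (mul_nonneg hs.le ?_)
      simp
      linarith
    · positivity

end Iid

/-! ### Conditional probabilities and the conditional entropy -/

section Cond

variable {A B : Type*} [Fintype A] [Fintype B]

/-- The conditional probability of `a` given `b`, with the value `0` if `b` has probability `0`. -/
noncomputable def condProb (Q : PMF (A × B)) (a : A) (b : B) : ℝ :=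
  (Q (a, b)).toReal / (Q.map Prod.snd b).toReal

omit [Fintype A] [Fintype B] in
theorem condProb_nonneg (Q : PMF (A × B)) (a : A) (b : B) : 0 ≤ condProb Q a b := by
  unfold condProb
  positivity

theorem map_snd_toReal (Q : PMF (A × B)) (b : B) :
    (Q.map Prod.snd b).toReal = ∑ a, (Q (a, b)).toReal := by
  classical
  rw [map_toReal, Fintype.sum_prod_type]
  simp

theorem toReal_le_map_snd (Q : PMF (A × B)) (a : A) (b : B) :
    (Q (a, b)).toReal ≤ (Q.map Prod.snd b).toReal := by
  rw [map_snd_toReal]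
  exact Finset.single_le_sum (f := fun a => (Q (a, b)).toReal)
    (fun _ _ => ENNReal.toReal_nonneg) (Finset.mem_univ a)

theorem map_snd_mul_condProb (Q : PMF (A × B)) (a : A) (b : B) :
    (Q.map Prod.snd b).toReal * condProb Q a b = (Q (a, b)).toReal := by
  by_cases h : (Q.map Prod.snd b).toReal = 0
  · have := toReal_le_map_snd Q a b
    rw [h, zero_mul]
    exact le_antisymm ENNReal.toReal_nonneg (h ▸ this)
  · exact mul_div_cancel₀ _ h

theorem sum_condProb_le_one (Q : PMF (A × B)) (b : B) : ∑ a, condProb Q a b ≤ 1 := by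
  simp only [condProb, ← Finset.sum_div, ← map_snd_toReal]
  exact div_self_le_one _

theorem condProb_pos (Q : PMF (A × B)) {w : A × B} (h : Q w ≠ 0) : 0 < condProb Q w.1 w.2 := by
  have h1 : 0 < (Q (w.1, w.2)).toReal := ENNReal.toReal_pos h (Q.apply_ne_top _)
  exact div_pos h1 (h1.trans_le (toReal_le_map_snd Q _ _))

/-- The conditional entropy is the mean of the conditional self-information. -/
theorem condEntropy_eq_sum (Q : PMF (A × B)) :
    condEntropy Q = ∑ w, (Q w).toReal * -Real.log (condProb Q w.1 w.2) := by
  rw [Fintype.sum_prod_type_right]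
  refine Finset.sum_congr rfl fun b _ => ?_
  rw [Finset.mul_sum]
  refine Finset.sum_congr rfl fun a _ => ?_
  change _ * Real.negMulLog (condProb Q a b) = _ * -Real.log (condProb Q a b)
  rw [← map_snd_mul_condProb, Real.negMulLog]
  ring

theorem condEntropy_nonneg (Q : PMF (A × B)) : 0 ≤ condEntropy Q := by
  rw [condEntropy_eq_sum]
  refine Finset.sum_nonneg fun w _ => mul_nonneg ENNReal.toReal_nonneg ?_
  refine neg_nonneg.2 (Real.log_nonpos (condProb_nonneg _ _ _) ?_)
  exact (Finset.single_le_sum (f := fun a => condProb Q a w.2)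
    (fun _ _ => condProb_nonneg _ _ _) (Finset.mem_univ w.1)).trans (sum_condProb_le_one Q w.2)

theorem iidExpect_sum_selfInfo (Q : PMF (A × B)) (n : ℕ) :
    iidExpect Q n (fun w => ∑ t, -Real.log (condProb Q (w t).1 (w t).2)) =
      n * condEntropy Q := by
  rw [iidExpect_sum Finset.univ Q fun t w => -Real.log (condProb Q (w t).1 (w t).2)]
  have h := fun t : Fin n => iidExpect_coord Q t fun p => -Real.log (condProb Q p.1 p.2)
  simp only [h, condEntropy_eq_sum]
  simp

end Cond

/-! ### Converse -/

section Converse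

variable {X Y V : Type*} [Fintype X] [Fintype Y]

/-- **Gibbs' inequality** for sequences with side information: a conditional sub-probability `q`
on the source sequences cannot have mean code length below the conditional entropy. -/
theorem iidExpect_log_le (Q : PMF (X × Y)) {n : ℕ} (q : (Fin n → X) → (Fin n → Y) → ℝ)
    (hq : ∀ x y, 0 < q x y) (hq1 : ∀ y, ∑ x, q x y ≤ 1) :
    n * condEntropy Q ≤
      iidExpect Q n fun w => -Real.log (q (fun t => (w t).1) fun t => (w t).2) := by
  have h1 : iidExpect Q n (fun w => ∑ t, -Real.log (condProb Q (w t).1 (w t).2)) +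
      (-1) * iidExpect Q n (fun w => -Real.log (q (fun t => (w t).1) fun t => (w t).2)) ≤
      iidExpect Q n (fun w => q (fun t => (w t).1) (fun t => (w t).2) /
        ∏ t, condProb Q (w t).1 (w t).2) + iidExpect Q n fun _ => -1 := by
    rw [← iidExpect_const_mul, ← iidExpect_add, ← iidExpect_add]
    refine iidExpect_mono Q fun w hw => ?_
    have hp : ∀ t, 0 < condProb Q (w t).1 (w t).2 := fun t => condProb_pos Q (hw t)
    have hpp := Finset.prod_pos fun t (_ : t ∈ Finset.univ) => hp t
    have := Real.log_le_sub_one_of_pos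
      (div_pos (hq (fun t => (w t).1) fun t => (w t).2) hpp)
    rw [Real.log_div (hq _ _).ne' hpp.ne', Real.log_prod fun t _ => (hp t).ne'] at this
    rw [Finset.sum_neg_distrib]
    linarith
  have h2 : iidExpect Q n (fun w => q (fun t => (w t).1) (fun t => (w t).2) /
        ∏ t, condProb Q (w t).1 (w t).2) ≤ 1 := by
    calc _ ≤ ∑ w : Fin n → X × Y, (∏ t, (Q.map Prod.snd (w t).2).toReal) *
            q (fun t => (w t).1) fun t => (w t).2 := by
          refine Finset.sum_le_sum fun w _ => ?_
          rw [mul_div_assoc', mul_div_right_comm, ← Finset.prod_div_distrib]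
          refine mul_le_mul_of_nonneg_right ?_ (hq _ _).le
          refine Finset.prod_le_prod
            (fun t _ => div_nonneg ENNReal.toReal_nonneg (condProb_nonneg _ _ _)) fun t _ => ?_
          have := map_snd_mul_condProb Q (w t).1 (w t).2
          refine div_le_of_le_mul₀ (condProb_nonneg _ _ _) ENNReal.toReal_nonneg ?_
          exact this.ge
      _ = ∑ y : Fin n → Y, (∏ t, (Q.map Prod.snd (y t)).toReal) * ∑ x, q x y := by
          rw [← (Equiv.arrowProdEquivProdArrow (Fin n) (fun _ => X) fun _ => Y).symm.sum_comp,
            Fintype.sum_prod_type_right]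
          simp only [Finset.mul_sum]
          rfl
      _ ≤ ∑ y : Fin n → Y, (∏ t, (Q.map Prod.snd (y t)).toReal) * 1 :=
          Finset.sum_le_sum fun y _ =>
            mul_le_mul_of_nonneg_left (hq1 y) (prod_toReal_nonneg _ y)
      _ = 1 := iidExpect_const (Q.map Prod.snd) n 1
  rw [iidExpect_sum_selfInfo, iidExpect_const] at h1
  linarith

/-- A code whose reproductions have small mean distortion describes the source in few nats, by the
code with lengths `-log q`, where `q` is the mixture over the messages of the product laws
proportional to `exp (-s * D)`. The conditional entropy is therefore bounded by the rate plus a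
term that is small when the distortion is. -/
theorem condEntropy_le_of_code (Q : PMF (X × Y)) (D : X → V → ℝ) {s C : ℝ}
    (hC : 0 < C) (hDC : ∀ v, ∑ x, Real.exp (-s * D x v) ≤ C) {n M : ℕ}
    (enc : (Fin n → X) → Fin M) (dec : Fin M → (Fin n → Y) → Fin n → V) :
    n * condEntropy Q ≤ Real.log M + n * Real.log C +
      s * ∑ t, iidExpect Q n fun w =>
        D (w t).1 (dec (enc fun r => (w r).1) (fun r => (w r).2) t) := by
  have hM : 0 < M := (enc fun _ => Q.support_nonempty.some.1).pos
  have hM' : (0 : ℝ) < M := by exact_mod_cast hM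
  let u : Fin M → (Fin n → X) → (Fin n → Y) → ℝ := fun m x y =>
    ∏ t, Real.exp (-s * D (x t) (dec m y t)) / C
  have hu : ∀ m x y, 0 < u m x y := fun m x y =>
    Finset.prod_pos fun t _ => div_pos (Real.exp_pos _) hC
  have hu1 : ∀ m y, ∑ x, u m x y ≤ 1 := by
    intro m y
    simp only [u]
    rw [← Fintype.prod_sum fun t x => Real.exp (-s * D x (dec m y t)) / C]
    refine Finset.prod_le_one (fun t _ => Finset.sum_nonneg fun x _ => by positivity)
      fun t _ => ?_
    rw [← Finset.sum_div]
    exact (div_le_one hC).2 (hDC _)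
  have hG := iidExpect_log_le Q (fun x y => (∑ m, u m x y) / M)
    (fun x y => div_pos (Finset.sum_pos (fun m _ => hu m x y) ⟨⟨0, hM⟩, Finset.mem_univ _⟩) hM')
    (fun y => by
      rw [← Finset.sum_div, Finset.sum_comm, div_le_one hM']
      calc _ ≤ ∑ m : Fin M, (1 : ℝ) := Finset.sum_le_sum fun m _ => hu1 m y
        _ = M := by simp)
  refine hG.trans ?_
  rw [← iidExpect_sum, ← iidExpect_const_mul, ← iidExpect_const Q n (Real.log M + n * Real.log C),
    ← iidExpect_add]
  refine iidExpect_mono Q fun w _ => ?_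
  set x : Fin n → X := fun t => (w t).1
  set y : Fin n → Y := fun t => (w t).2
  have h1 : u (enc x) x y / M ≤ (∑ m, u m x y) / M :=
    div_le_div_of_nonneg_right (Finset.single_le_sum (f := fun m => u m x y)
      (fun m _ => (hu m x y).le) (Finset.mem_univ _)) hM'.le
  have h2 := Real.log_le_log (div_pos (hu _ _ _) hM') h1
  rw [Real.log_div (hu _ _ _).ne' hM'.ne'] at h2
  have h3 : Real.log (u (enc x) x y) =
      -s * ∑ t, D (x t) (dec (enc x) y t) - n * Real.log C := by
    simp only [u]
    rw [Real.log_prod fun t _ => (div_pos (Real.exp_pos _) hC).ne']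
    simp only [Real.log_div (Real.exp_pos _).ne' hC.ne', Real.log_exp]
    simp [Finset.sum_sub_distrib, Finset.mul_sum]
  have h4 : ∑ t, D (w t).1 (dec (enc x) y t) = ∑ t, D (x t) (dec (enc x) y t) := rfl
  rw [h4]
  linarith

/-- If no reproduction symbol is at distortion `0` from two source symbols, the partition functions
of `exp (-s * D)` are nearly bounded by `1` for large `s`. -/
theorem exists_sum_exp_le [Fintype V] (D : X → V → ℝ) (hD : ∀ x v, 0 ≤ D x v)
    (hinj : ∀ x x' v, D x v = 0 → D x' v = 0 → x = x') {ε : ℝ} (hε : 0 < ε) :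
    ∃ s : ℝ, 0 < s ∧ ∀ v, ∑ x, Real.exp (-s * D x v) ≤ 1 + ε := by
  classical
  have h : ∀ v, ∀ᶠ s : ℝ in atTop, ∑ x, Real.exp (-s * D x v) < 1 + ε := by
    intro v
    have hl : Tendsto (fun s : ℝ => ∑ x, Real.exp (-s * D x v)) atTop
        (𝓝 (∑ x, if D x v = 0 then 1 else 0)) := by
      refine tendsto_finsetSum _ fun x _ => ?_
      split_ifs with hx
      · simp [hx]
      · refine Real.tendsto_exp_atBot.comp ?_
        exact (tendsto_neg_atTop_atBot).atBot_mul_const ((hD x v).lt_of_ne' hx)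
    refine hl.eventually_lt_const (lt_of_le_of_lt ?_ (lt_add_of_pos_right 1 hε))
    rw [Finset.sum_boole]
    have : (Finset.univ.filter fun x => D x v = 0).card ≤ 1 :=
      Finset.card_le_one.2 fun a ha b hb =>
        hinj a b v (Finset.mem_filter.1 ha).2 (Finset.mem_filter.1 hb).2
    exact_mod_cast this
  obtain ⟨s, hs, hs0⟩ := ((eventually_all.2 h).and (eventually_gt_atTop 0)).exists
  exact ⟨s, hs0, fun v => (hs v).le⟩

/-- Lossless converse for one decoder. -/
theorem condEntropy_le_of_achievable [Fintype V] {ι : Type*} [Fintype ι] (Q : PMF (X × Y))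
    (d : ι → X → V → ℝ≥0)
    (hinj : ∀ x x' v, (∀ i, d i x v = 0) → (∀ i, d i x' v = 0) → x = x') {R : ℝ}
    (h : ∀ γ : ℝ, 0 < γ → ∃ (n M : ℕ) (enc : (Fin n → X) → Fin M)
      (dec : Fin M → (Fin n → Y) → Fin n → V), 0 < n ∧ (1 / (n : ℝ)) * Real.log M ≤ R + γ ∧
      ∀ i, (1 / (n : ℝ)) * ∑ t, iidExpect Q n (fun w =>
        (d i (w t).1 (dec (enc fun r => (w r).1) (fun r => (w r).2) t) : ℝ)) ≤ γ) :
    condEntropy Q ≤ R := by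
  let D : X → V → ℝ := fun x v => ∑ i, (d i x v : ℝ)
  have hD0 : ∀ x v, 0 ≤ D x v := fun x v => Finset.sum_nonneg fun i _ => (d i x v).2
  have hD : ∀ x v, D x v = 0 → ∀ i, d i x v = 0 := fun x v hx i => by
    have := (Finset.sum_eq_zero_iff_of_nonneg fun i _ => (d i x v).2).1 hx i (Finset.mem_univ i)
    exact NNReal.coe_eq_zero.1 this
  refine le_of_forall_pos_le_add fun ε hε => ?_
  obtain ⟨s, hs, hsC⟩ := exists_sum_exp_le D hD0
    (fun x x' v h1 h2 => hinj x x' v (hD _ _ h1) (hD _ _ h2)) (half_pos hε)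
  have hK : 0 < 1 + s * Fintype.card ι := by positivity
  obtain ⟨n, M, enc, dec, hn, hM, hd⟩ :=
    h (ε / 2 / (1 + s * Fintype.card ι)) (by positivity)
  set γ := ε / 2 / (1 + s * Fintype.card ι) with hγ
  have hγe : γ * (1 + s * Fintype.card ι) = ε / 2 := by rw [hγ]; field_simp
  have hn' : (0 : ℝ) < n := by exact_mod_cast hn
  have hmain := condEntropy_le_of_code Q D (by positivity) hsC enc dec
  have hsum : ∑ t, iidExpect Q n (fun w =>
      D (w t).1 (dec (enc fun r => (w r).1) (fun r => (w r).2) t)) ≤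
      n * (Fintype.card ι * γ) := by
    simp only [D, iidExpect_sum]
    rw [Finset.sum_comm]
    calc _ ≤ ∑ i : ι, n * γ := by
          refine Finset.sum_le_sum fun i _ => ?_
          have := hd i
          rw [one_div, inv_mul_le_iff₀ hn'] at this
          exact this
      _ = _ := by simp; ring
  rw [one_div, inv_mul_le_iff₀ hn'] at hM
  have hlog : Real.log (1 + ε / 2) ≤ ε / 2 := by
    have := Real.log_le_sub_one_of_pos (show 0 < 1 + ε / 2 by positivity)
    linarith
  have : n * condEntropy Q ≤ n * (R + ε) := by
    have e1 := mul_le_mul_of_nonneg_left hsum hs.le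
    have e2 := mul_le_mul_of_nonneg_left hlog hn'.le
    have e3 : n * (R + ε) = n * (R + γ) + s * (n * (Fintype.card ι * γ)) + n * (ε / 2) := by
      linear_combination (-(n : ℝ)) * hγe
    linarith
  exact le_of_mul_le_mul_left this hn'

end Converse

/-! ### Achievability by random binning -/

section Binning

/-- A uniformly random map to `Fin M` identifies two given points with probability `1 / M`. -/
theorem mul_sum_collision {α : Type*} [Fintype α] [DecidableEq α] {M : ℕ} {x x' : α}
    (hx : x' ≠ x) :
    (M : ℝ) * ∑ f : α → Fin M, (if f x' = f x then 1 else 0) = Fintype.card (α → Fin M) := by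
  rcases Nat.eq_zero_or_pos M with rfl | hM
  · have : IsEmpty (α → Fin 0) := ⟨fun f => (f x).elim0⟩
    simp
  · have : NeZero M := ⟨hM.ne'⟩
    -- Translating the value at `x` by `c` permutes the maps, so all differences of the two values
    -- are equally likely.
    have h : ∀ c : Fin M, ∑ f : α → Fin M, (if f x' = f x then (1 : ℝ) else 0) =
        ∑ f : α → Fin M, (if f x' = f x + c then (1 : ℝ) else 0) := by
      intro c
      let e : (α → Fin M) ≃ (α → Fin M) := Equiv.piCongrRight fun i =>
        if i = x then Equiv.addRight c else Equiv.refl _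
      rw [← e.sum_comp]
      simp [e, hx]
    calc _ = ∑ c : Fin M, ∑ f : α → Fin M, (if f x' = f x then (1 : ℝ) else 0) := by simp
      _ = ∑ f : α → Fin M, ∑ c : Fin M, (if f x' = f x + c then (1 : ℝ) else 0) :=
          (Finset.sum_congr rfl fun c _ => h c).trans Finset.sum_comm
      _ = _ := by
          have : ∀ (f : α → Fin M) (c : Fin M), (f x' = f x + c) ↔ c = f x' - f x := fun f c =>
            ⟨fun h => by rw [h, add_sub_cancel_left], fun h => by rw [h, add_sub_cancel]⟩
          simp [this]

open Classical in
/-- Union bound over the points of `T` for a uniformly random map. -/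
theorem sum_exists_collision_le {α : Type*} [Fintype α] [DecidableEq α] {M : ℕ} (hM : 0 < M) (T : Finset α)
    (x : α) :
    ∑ f : α → Fin M, (if ∃ x' ∈ T, x' ≠ x ∧ f x' = f x then (1 : ℝ) else 0) ≤
      Fintype.card (α → Fin M) * (T.card / M) := by
  have hM' : (0 : ℝ) < M := by exact_mod_cast hM
  calc _ ≤ ∑ f : α → Fin M, ∑ x' ∈ T.erase x, (if f x' = f x then (1 : ℝ) else 0) := by
        refine Finset.sum_le_sum fun f _ => ?_
        split_ifs with h
        · obtain ⟨x', hx', hne, hf⟩ := h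
          refine le_trans (by simp [hf]) (Finset.single_le_sum
            (f := fun x' => if f x' = f x then (1 : ℝ) else 0)
            (fun i _ => by split_ifs <;> norm_num)
            (Finset.mem_erase.2 ⟨hne, hx'⟩))
        · exact Finset.sum_nonneg fun i _ => by split_ifs <;> norm_num
    _ = ∑ x' ∈ T.erase x, (Fintype.card (α → Fin M) : ℝ) / M := by
        rw [Finset.sum_comm]
        refine Finset.sum_congr rfl fun x' hx' => ?_
        rw [eq_div_iff hM'.ne', mul_comm]
        exact mul_sum_collision (Finset.ne_of_mem_erase hx')
    _ ≤ ∑ x' ∈ T, (Fintype.card (α → Fin M) : ℝ) / M :=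
        Finset.sum_le_sum_of_subset_of_nonneg (Finset.erase_subset _ _)
          fun _ _ _ => by positivity
    _ = _ := by simp; ring

variable {X Y Z : Type*} [Fintype X] [Fintype Y] [Fintype Z]

open Classical in
/-- The source sequences of conditional probability at least `exp (-n * a)` given `y`. -/
noncomputable def likelySet (Q : PMF (X × Y)) (n : ℕ) (a : ℝ) (y : Fin n → Y) :
    Finset (Fin n → X) :=
  {x | Real.exp (-(n * a)) ≤ ∏ t, condProb Q (x t) (y t)}

theorem card_likelySet_le (Q : PMF (X × Y)) (n : ℕ) (a : ℝ) (y : Fin n → Y) :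
    ((likelySet Q n a y).card : ℝ) ≤ Real.exp (n * a) := by
  have h1 : (likelySet Q n a y).card * Real.exp (-(n * a)) ≤ 1 := by
    rw [← nsmul_eq_mul]
    calc _ ≤ ∑ x ∈ likelySet Q n a y, ∏ t, condProb Q (x t) (y t) :=
          Finset.card_nsmul_le_sum _ _ _ fun x hx => (Finset.mem_filter.1 hx).2
      _ ≤ ∑ x : Fin n → X, ∏ t, condProb Q (x t) (y t) :=
          Finset.sum_le_sum_of_subset_of_nonneg (Finset.subset_univ _)
            fun x _ _ => Finset.prod_nonneg fun t _ => condProb_nonneg _ _ _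
      _ = ∏ t, ∑ x, condProb Q x (y t) := (Fintype.prod_sum fun t x => condProb Q x (y t)).symm
      _ ≤ 1 := Finset.prod_le_one
          (fun t _ => Finset.sum_nonneg fun x _ => condProb_nonneg _ _ _)
          fun t _ => sum_condProb_le_one Q (y t)
  rwa [Real.exp_neg, ← div_eq_mul_inv, div_le_one (Real.exp_pos _)] at h1

/-- Decoding within the likely set fails for the bin assignment `f`: the source sequence is not
likely, or it shares its bin with another likely one. -/
def BinningFails (Q : PMF (X × Y)) {n M : ℕ} (a : ℝ) (f : (Fin n → X) → Fin M)
    (x : Fin n → X) (y : Fin n → Y) : Prop :=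
  x ∉ likelySet Q n a y ∨ ∃ x' ∈ likelySet Q n a y, x' ≠ x ∧ f x' = f x

open Classical in
/-- The probability of a binning failure. -/
noncomputable def failProb (Q : PMF (X × Y)) {n M : ℕ} (a : ℝ) (f : (Fin n → X) → Fin M) : ℝ :=
  iidExpect Q n fun w => if BinningFails Q a f (fun t => (w t).1) (fun t => (w t).2) then 1 else 0

theorem failProb_nonneg (Q : PMF (X × Y)) {n M : ℕ} (a : ℝ) (f : (Fin n → X) → Fin M) :
    0 ≤ failProb Q a f := by
  refine Finset.sum_nonneg fun w _ => mul_nonneg (prod_toReal_nonneg Q w) ?_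
  dsimp only
  split_ifs <;> norm_num

/-- The probability that the conditional self-information of `n` symbols exceeds `n * a`. -/
noncomputable def escapeProb (Q : PMF (X × Y)) (a : ℝ) (n : ℕ) : ℝ :=
  iidExpect Q n fun w => if n * a < ∑ t, -Real.log (condProb Q (w t).1 (w t).2) then 1 else 0

theorem tendsto_escapeProb (Q : PMF (X × Y)) {a : ℝ} (h : condEntropy Q < a) :
    Tendsto (escapeProb Q a) atTop (𝓝 0) := by
  rw [condEntropy_eq_sum] at h
  unfold escapeProb
  exact tendsto_iidExpect_exceed Q (fun w => -Real.log (condProb Q w.1 w.2)) h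

open Classical in
theorem iidExpect_notMem_likelySet_le (Q : PMF (X × Y)) (n : ℕ) (a : ℝ) :
    iidExpect Q n (fun w =>
      if (fun t => (w t).1) ∉ likelySet Q n a (fun t => (w t).2) then 1 else 0) ≤
      escapeProb Q a n := by
  refine iidExpect_mono Q fun w hw => ?_
  have hp : ∀ t, 0 < condProb Q (w t).1 (w t).2 := fun t => condProb_pos Q (hw t)
  by_cases h : (fun t => (w t).1) ∈ likelySet Q n a (fun t => (w t).2)
  · simp only [h, not_true_eq_false, if_false]
    split_ifs <;> norm_num
  · have h1 : ∏ t, condProb Q (w t).1 (w t).2 < Real.exp (-(n * a)) := by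
      simpa [likelySet] using h
    have h2 := (Real.log_lt_iff_lt_exp (Finset.prod_pos fun t _ => hp t)).2 h1
    rw [Real.log_prod fun t _ => (hp t).ne'] at h2
    rw [if_pos h, if_pos]
    rw [Finset.sum_neg_distrib]
    linarith

/-- The average of the failure probability over all bin assignments. -/
theorem sum_failProb_le [DecidableEq X] (Q : PMF (X × Y)) {n M : ℕ} (hM : 0 < M) (a : ℝ) :
    ∑ f : (Fin n → X) → Fin M, failProb Q a f ≤
      Fintype.card ((Fin n → X) → Fin M) * (escapeProb Q a n + Real.exp (n * a) / M) := by
  classical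
  unfold failProb
  rw [← iidExpect_sum]
  refine le_trans ?_ (mul_le_mul_of_nonneg_left
    (add_le_add_left (iidExpect_notMem_likelySet_le Q n a) _) (Nat.cast_nonneg _))
  rw [← iidExpect_const Q n (Real.exp (n * a) / M), ← iidExpect_add, ← iidExpect_const_mul]
  refine iidExpect_mono Q fun w _ => ?_
  have hc := sum_exists_collision_le hM (likelySet Q n a fun t => (w t).2) fun t => (w t).1
  have hc' : (Fintype.card ((Fin n → X) → Fin M) : ℝ) *
      ((likelySet Q n a fun t => (w t).2).card / M) ≤
      Fintype.card ((Fin n → X) → Fin M) * (Real.exp (n * a) / M) := by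
    gcongr
    exact card_likelySet_le Q n a _
  unfold BinningFails
  by_cases h : (fun t => (w t).1) ∈ likelySet Q n a (fun t => (w t).2)
  · simp only [h, not_true_eq_false, if_false, false_or, zero_add]
    convert hc.trans hc' using 3
  · simp only [h, not_false_eq_true, true_or, if_true, Finset.sum_const, Finset.card_univ,
      nsmul_eq_mul]
    refine mul_le_mul_of_nonneg_left ?_ (Nat.cast_nonneg _)
    exact le_add_of_nonneg_right (by positivity)

omit [Fintype Y] in
/-- The decoder which picks a likely sequence in the announced bin is correct unless binning
fails. -/
theorem exists_decoder (Q : PMF (X × Y)) {n M : ℕ} (a : ℝ) (f : (Fin n → X) → Fin M) :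
    ∃ g : Fin M → (Fin n → Y) → Fin n → X, ∀ x y, ¬ BinningFails Q a f x y → g (f x) y = x := by
  have hX : Nonempty X := ⟨Q.support_nonempty.some.1⟩
  have : ∀ m y, ∃ z : Fin n → X,
      (∃ x ∈ likelySet Q n a y, f x = m) → z ∈ likelySet Q n a y ∧ f z = m := by
    intro m y
    by_cases h : ∃ x ∈ likelySet Q n a y, f x = m
    · obtain ⟨z, hz⟩ := h
      exact ⟨z, fun _ => hz⟩
    · exact ⟨fun _ => hX.some, fun h' => absurd h' h⟩
  choose g hg using this
  refine ⟨g, fun x y h => ?_⟩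
  simp only [BinningFails, not_or, not_not, not_exists, not_and] at h
  obtain ⟨h1, h2⟩ := hg (f x) y ⟨x, h.1, rfl⟩
  by_contra hne
  exact h.2 _ h1 hne h2

/-- **Binning for two decoders**: at a rate `b` above both conditional entropies, one bin
assignment serves both decoders. -/
theorem eventually_exists_binning (Q₁ : PMF (X × Y)) (Q₂ : PMF (X × Z)) {a b ε : ℝ}
    (h₁ : condEntropy Q₁ < a) (h₂ : condEntropy Q₂ < a) (hab : a < b) (hε : 0 < ε) :
    ∀ᶠ n : ℕ in atTop, ∃ (M : ℕ) (f : (Fin n → X) → Fin M), 0 < M ∧ Real.log M ≤ n * b ∧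
      failProb Q₁ a f ≤ ε ∧ failProb Q₂ a f ≤ ε := by
  classical
  have hb : 0 < b := by linarith [condEntropy_nonneg Q₁]
  have t₃ : Tendsto (fun n : ℕ => 4 * Real.exp (n * (a - b))) atTop (𝓝 0) := by
    have : Tendsto (fun n : ℕ => (n : ℝ) * (a - b)) atTop atBot :=
      tendsto_natCast_atTop_atTop.atTop_mul_const_of_neg (sub_neg.2 hab)
    simpa using (Real.tendsto_exp_atBot.comp this).const_mul 4
  have t := ((tendsto_escapeProb Q₁ h₁).add (tendsto_escapeProb Q₂ h₂)).add t₃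
  simp only [add_zero] at t
  filter_upwards [t.eventually_lt_const hε] with n hn
  obtain ⟨M, hM1, hMle, hMge⟩ :
      ∃ M : ℕ, 0 < M ∧ (M : ℝ) ≤ Real.exp (n * b) ∧ Real.exp (n * b) ≤ 2 * M := by
    have h1 : 1 ≤ ⌊Real.exp (n * b)⌋₊ :=
      Nat.le_floor (by simpa using Real.one_le_exp (by positivity))
    have h1' : (1 : ℝ) ≤ ⌊Real.exp (n * b)⌋₊ := by exact_mod_cast h1
    have := Nat.lt_floor_add_one (Real.exp (n * b))
    exact ⟨_, h1, Nat.floor_le (Real.exp_pos _).le, by linarith⟩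
  have hM1' : (1 : ℝ) ≤ M := by exact_mod_cast hM1
  have hratio : Real.exp (n * a) / M ≤ 2 * Real.exp (n * (a - b)) := by
    rw [div_le_iff₀ (by linarith), mul_sub, Real.exp_sub, mul_div_assoc', div_mul_eq_mul_div,
      le_div_iff₀ (Real.exp_pos _)]
    nlinarith [Real.exp_pos (n * a)]
  have : Nonempty (Fin M) := ⟨⟨0, hM1⟩⟩
  obtain ⟨f, -, hf⟩ := Finset.exists_le_of_sum_le
    (s := (Finset.univ : Finset ((Fin n → X) → Fin M)))
    (f := fun f => failProb Q₁ a f + failProb Q₂ a f)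
    (g := fun _ => (escapeProb Q₁ a n + Real.exp (n * a) / M) +
      (escapeProb Q₂ a n + Real.exp (n * a) / M)) Finset.univ_nonempty (by
        rw [Finset.sum_add_distrib, Finset.sum_const, Finset.card_univ, nsmul_eq_mul, mul_add]
        exact add_le_add (sum_failProb_le Q₁ hM1 a) (sum_failProb_le Q₂ hM1 a))
  have n₁ := failProb_nonneg Q₁ a f
  have n₂ := failProb_nonneg Q₂ a f
  refine ⟨M, f, hM1, ?_, by linarith, by linarith⟩
  rwa [Real.log_le_iff_le_exp (by linarith)]

/-- The distortion of a decoder that recovers the source sequence and reproduces it perfectly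
unless binning fails. -/
theorem distortion_le_failProb {V : Type*} (Q : PMF (X × Y)) {n M : ℕ} {a K : ℝ}
    (f : (Fin n → X) → Fin M) (g : Fin M → (Fin n → Y) → Fin n → X)
    (hg : ∀ x y, ¬ BinningFails Q a f x y → g (f x) y = x) (rep : X → V) (d : X → V → ℝ≥0)
    (hrep : ∀ x, d x (rep x) = 0) (hK : ∀ x v, (d x v : ℝ) ≤ K) :
    (1 / (n : ℝ)) * ∑ t : Fin n, iidExpect Q n (fun w =>
      (d (w t).1 (rep (g (f fun r => (w r).1) (fun r => (w r).2) t)) : ℝ)) ≤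
      K * failProb Q a f := by
  classical
  have h : ∀ t : Fin n, iidExpect Q n (fun w =>
      (d (w t).1 (rep (g (f fun r => (w r).1) (fun r => (w r).2) t)) : ℝ)) ≤
      K * failProb Q a f := by
    intro t
    unfold failProb
    rw [← iidExpect_const_mul]
    refine iidExpect_mono Q fun w _ => ?_
    split_ifs with hb
    · simpa using hK _ _
    · rw [hg _ _ hb]
      simp [hrep]
  have hs := Finset.sum_le_sum fun t (_ : t ∈ Finset.univ) => h t
  rw [Finset.sum_const, Finset.card_univ, Fintype.card_fin, nsmul_eq_mul] at hs
  rcases Nat.eq_zero_or_pos n with rfl | hn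
  · have : 0 ≤ K := by
      obtain ⟨p, -⟩ := Q.support_nonempty
      exact (d p.1 (rep p.1)).2.trans (hK _ _)
    simpa using mul_nonneg this (failProb_nonneg Q a f)
  · have hn' : (0 : ℝ) < n := by exact_mod_cast hn
    rwa [one_div, inv_mul_le_iff₀ hn']

end Binning

/-! ### The rate-distortion function at distortion zero -/

section Rate

variable {X Y Z Xh Xt ι : Type*} [Fintype X] [Fintype Y] [Fintype Z]

theorem Code.distortion₁_eq {n : ℕ} (c : Code X Y Z Xh Xt n) (P : PMF (X × Y × Z))
    (d : X → Xh → ℝ≥0) :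
    c.distortion₁ P d = (1 / (n : ℝ)) * ∑ t : Fin n, iidExpect (lawXY P) n fun w =>
      (d (w t).1 (c.dec₁ (c.enc fun s => (w s).1) (fun s => (w s).2) t) : ℝ) := by
  simp only [Code.distortion₁, lawXY, iidExpect_map]

theorem Code.distortion₂_eq {n : ℕ} (c : Code X Y Z Xh Xt n) (P : PMF (X × Y × Z))
    (d : X → Xt → ℝ≥0) :
    c.distortion₂ P d = (1 / (n : ℝ)) * ∑ t : Fin n, iidExpect (lawXZ P) n fun w =>
      (d (w t).1 (c.dec₂ (c.enc fun s => (w s).1) (fun s => (w s).2) t) : ℝ) := by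
  simp only [Code.distortion₂, lawXZ, iidExpect_map]

variable [Finite Xh] [Finite Xt] [Finite ι]

theorem exists_distortion_bound {V : Type*} [Finite V] (d : ι → X → V → ℝ≥0) :
    ∃ K : ℝ, 0 < K ∧ ∀ i x v, (d i x v : ℝ) ≤ K := by
  obtain ⟨K, hK⟩ := (Set.finite_range fun p : ι × X × V => d p.1 p.2.1 p.2.2).bddAbove
  refine ⟨K + 1, by positivity, fun i x v => ?_⟩
  have : d i x v ≤ K := hK ⟨(i, x, v), rfl⟩
  have : (d i x v : ℝ) ≤ K := by exact_mod_cast this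
  linarith

theorem achievable_of_condEntropy_le (P : PMF (X × Y × Z)) (dh : ι → X → Xh → ℝ≥0)
    (dt : ι → X → Xt → ℝ≥0) (hh : ∀ x, ∃ v, ∀ i, dh i x v = 0)
    (ht : ∀ x, ∃ v, ∀ i, dt i x v = 0) {R : ℝ} (h₁ : condEntropy (lawXY P) ≤ R)
    (h₂ : condEntropy (lawXZ P) ≤ R) : Achievable P dh dt 0 0 R := by
  intro γ hγ
  choose reph hreph using hh
  choose rept hrept using ht
  obtain ⟨K₁, hK₁, hd₁⟩ := exists_distortion_bound dh
  obtain ⟨K₂, hK₂, hd₂⟩ := exists_distortion_bound dt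
  have hX : Nonempty X := ⟨P.support_nonempty.some.1⟩
  let good : (n : ℕ) → Code X Y Z Xh Xt n → Prop := fun n c =>
    (1 / (n : ℝ)) * Real.log (c.M : ℝ) ≤ R + γ ∧
      ∀ i, c.distortion₁ P (dh i) ≤ γ ∧ c.distortion₂ P (dt i) ≤ γ
  have hex : ∀ n, ∃ c : Code X Y Z Xh Xt n, (∃ c', good n c') → good n c := by
    intro n
    by_cases h : ∃ c', good n c'
    · obtain ⟨c, hc⟩ := h
      exact ⟨c, fun _ => hc⟩
    · exact ⟨⟨1, fun _ => 0, fun _ _ _ => reph hX.some, fun _ _ _ => rept hX.some⟩,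
        fun h' => absurd h' h⟩
  choose c hc using hex
  refine ⟨c, ?_⟩
  -- Half of the slack `γ` separates the typicality level from the binning rate.
  have hev := eventually_exists_binning (lawXY P) (lawXZ P) (a := R + γ / 2) (b := R + γ)
    (ε := γ / (K₁ + K₂)) (by linarith) (by linarith) (by linarith) (by positivity)
  filter_upwards [hev, eventually_gt_atTop 0] with n hn hn0
  obtain ⟨M, f, -, hlog, hf₁, hf₂⟩ := hn
  have hn' : (0 : ℝ) < n := by exact_mod_cast hn0
  obtain ⟨g₁, hg₁⟩ := exists_decoder (lawXY P) (R + γ / 2) f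
  obtain ⟨g₂, hg₂⟩ := exists_decoder (lawXZ P) (R + γ / 2) f
  have hK : ∀ K, 0 < K → K ≤ K₁ + K₂ → ∀ p, p ≤ γ / (K₁ + K₂) → K * p ≤ γ := by
    intro K hK hKle p hp
    calc K * p ≤ K * (γ / (K₁ + K₂)) := mul_le_mul_of_nonneg_left hp hK.le
      _ ≤ (K₁ + K₂) * (γ / (K₁ + K₂)) := mul_le_mul_of_nonneg_right hKle (by positivity)
      _ = γ := by field_simp
  simp only [Pi.zero_apply, zero_add]
  refine hc n ⟨⟨M, f, fun m y t => reph (g₁ m y t), fun m z t => rept (g₂ m z t)⟩, ?_, ?_⟩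
  · rw [one_div, inv_mul_le_iff₀ hn']
    exact hlog
  · refine fun i => ⟨?_, ?_⟩
    · rw [Code.distortion₁_eq]
      exact (distortion_le_failProb (lawXY P) f g₁ hg₁ reph (dh i) (fun x => hreph x i)
        (hd₁ i)).trans (hK _ hK₁ (by linarith) _ hf₁)
    · rw [Code.distortion₂_eq]
      exact (distortion_le_failProb (lawXZ P) f g₂ hg₂ rept (dt i) (fun x => hrept x i)
        (hd₂ i)).trans (hK _ hK₂ (by linarith) _ hf₂)

theorem condEntropy_le_of_achievable_zero (P : PMF (X × Y × Z)) (dh : ι → X → Xh → ℝ≥0)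
    (dt : ι → X → Xt → ℝ≥0)
    (hh : ∀ x x' v, (∀ i, dh i x v = 0) → (∀ i, dh i x' v = 0) → x = x')
    (ht : ∀ x x' v, (∀ i, dt i x v = 0) → (∀ i, dt i x' v = 0) → x = x') {R : ℝ}
    (hR : Achievable P dh dt 0 0 R) :
    condEntropy (lawXY P) ≤ R ∧ condEntropy (lawXZ P) ≤ R := by
  have := Fintype.ofFinite Xh
  have := Fintype.ofFinite Xt
  have := Fintype.ofFinite ι
  constructor
  · refine condEntropy_le_of_achievable (lawXY P) dh hh fun γ hγ => ?_
    obtain ⟨c, hc⟩ := hR γ hγ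
    obtain ⟨n, ⟨hM, hd⟩, hn⟩ := (hc.and (eventually_gt_atTop 0)).exists
    refine ⟨n, _, (c n).enc, (c n).dec₁, hn, hM, fun i => ?_⟩
    have := (hd i).1
    rwa [Code.distortion₁_eq, Pi.zero_apply, zero_add] at this
  · refine condEntropy_le_of_achievable (lawXZ P) dt ht fun γ hγ => ?_
    obtain ⟨c, hc⟩ := hR γ hγ
    obtain ⟨n, ⟨hM, hd⟩, hn⟩ := (hc.and (eventually_gt_atTop 0)).exists
    refine ⟨n, _, (c n).enc, (c n).dec₂, hn, hM, fun i => ?_⟩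
    have := (hd i).2
    rwa [Code.distortion₂_eq, Pi.zero_apply, zero_add] at this

/-- The rates at which both decoders can reproduce an arbitrary source: the worse decoder decides.
The criteria in the family need to pin down the source symbol only jointly. -/
theorem achievableRates_zero_eq_Ici (P : PMF (X × Y × Z)) (dh : ι → X → Xh → ℝ≥0)
    (dt : ι → X → Xt → ℝ≥0) (hh : ∀ x, ∃ v, ∀ i, dh i x v = 0)
    (hh' : ∀ x x' v, (∀ i, dh i x v = 0) → (∀ i, dh i x' v = 0) → x = x')
    (ht : ∀ x, ∃ v, ∀ i, dt i x v = 0)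
    (ht' : ∀ x x' v, (∀ i, dt i x v = 0) → (∀ i, dt i x' v = 0) → x = x') :
    achievableRates P dh dt 0 0 =
      Set.Ici (max (condEntropy (lawXY P)) (condEntropy (lawXZ P))) := by
  ext R
  rw [Set.mem_Ici, max_le_iff]
  exact ⟨condEntropy_le_of_achievable_zero P dh dt hh' ht',
    fun h => achievable_of_condEntropy_le P dh dt hh ht h.1 h.2⟩

omit [Finite ι] in
theorem componentRD_zero_eq (P : PMF (X × Y × Z)) (dh : X → Xh → ℝ≥0) (dt : X → Xt → ℝ≥0)
    (hh : ZeroMeansExact dh) (ht : ZeroMeansExact dt) :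
    componentRD P dh dt 0 0 = max (condEntropy (lawXY P)) (condEntropy (lawXZ P)) := by
  have h := achievableRates_zero_eq_Ici (ι := Unit) P (fun _ => dh) (fun _ => dt)
    (fun x => (hh.1 x).imp fun v hv _ => hv) (fun x x' v h h' => hh.2 x x' v (h ()) (h' ()))
    (fun x => (ht.1 x).imp fun v hv _ => hv) (fun x x' v h h' => ht.2 x x' v (h ()) (h' ()))
  exact (congrArg sInf h).trans csInf_Ici

end Rate

/-! ### Product sources -/

section Product

theorem bind_map_apply {A B C : Type*} (p : PMF A) (q : PMF B) {e : A → B → C}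
    (he : Function.Injective2 e) (a : A) (b : B) :
    (p.bind fun u => q.map (e u)) (e a b) = p a * q b := by
  classical
  rw [PMF.bind_apply, tsum_eq_single a]
  · rw [PMF.map_apply, tsum_eq_single b]
    · simp
    · intro b' hb'
      rw [if_neg fun h => hb' (he h).2.symm]
  · intro a' ha'
    rw [PMF.map_apply, ENNReal.tsum_eq_zero.2, mul_zero]
    intro b'
    rw [if_neg fun h => ha' (he h).1.symm]

/-- The conditional entropy of two independent pairs is the sum of the conditional entropies. -/
theorem condEntropy_prod {A₁ B₁ A₂ B₂ : Type*} [Fintype A₁] [Fintype B₁] [Fintype A₂]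
    [Fintype B₂] (Q : PMF ((A₁ × A₂) × B₁ × B₂)) (Q₁ : PMF (A₁ × B₁)) (Q₂ : PMF (A₂ × B₂))
    (h : ∀ a₁ a₂ b₁ b₂, Q ((a₁, a₂), (b₁, b₂)) = Q₁ (a₁, b₁) * Q₂ (a₂, b₂)) :
    condEntropy Q = condEntropy Q₁ + condEntropy Q₂ := by
  have hm : ∀ b₁ b₂, (Q.map Prod.snd (b₁, b₂)).toReal =
      (Q₁.map Prod.snd b₁).toReal * (Q₂.map Prod.snd b₂).toReal := by
    intro b₁ b₂
    simp only [map_snd_toReal, Fintype.sum_prod_type, h, ENNReal.toReal_mul, Finset.sum_mul_sum]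
  have hc : ∀ a₁ a₂ b₁ b₂, condProb Q (a₁, a₂) (b₁, b₂) =
      condProb Q₁ a₁ b₁ * condProb Q₂ a₂ b₂ := by
    intro a₁ a₂ b₁ b₂
    simp only [condProb, h, hm, ENNReal.toReal_mul, mul_div_mul_comm]
  have hterm : ∀ (u : A₁ × B₁) (v : A₂ × B₂),
      (Q ((u.1, v.1), (u.2, v.2))).toReal * -Real.log (condProb Q (u.1, v.1) (u.2, v.2)) =
      (Q₁ u).toReal * -Real.log (condProb Q₁ u.1 u.2) * (Q₂ v).toReal +
      (Q₁ u).toReal * ((Q₂ v).toReal * -Real.log (condProb Q₂ v.1 v.2)) := by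
    intro u v
    rw [h, hc, ENNReal.toReal_mul]
    by_cases h₁ : Q₁ u = 0
    · simp [h₁]
    by_cases h₂ : Q₂ v = 0
    · simp [h₂]
    rw [Real.log_mul (condProb_pos Q₁ h₁).ne' (condProb_pos Q₂ h₂).ne']
    ring
  simp only [condEntropy_eq_sum]
  rw [← (Equiv.prodProdProdComm A₁ B₁ A₂ B₂).sum_comp, Fintype.sum_prod_type]
  calc _ = ∑ u : A₁ × B₁, ∑ v : A₂ × B₂,
        ((Q₁ u).toReal * -Real.log (condProb Q₁ u.1 u.2) * (Q₂ v).toReal +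
        (Q₁ u).toReal * ((Q₂ v).toReal * -Real.log (condProb Q₂ v.1 v.2))) :=
        Finset.sum_congr rfl fun u _ => Finset.sum_congr rfl fun v _ => hterm u v
    _ = _ := by
        simp only [Finset.sum_add_distrib, ← Finset.mul_sum, ← Finset.sum_mul, sum_toReal,
          mul_one, one_mul]

variable {X₁ Y₁ Z₁ X₂ Y₂ Z₂ : Type*}

theorem lawXY_productSource_apply (P₁ : PMF (X₁ × Y₁ × Z₁)) (P₂ : PMF (X₂ × Y₂ × Z₂))
    (a₁ : X₁) (a₂ : X₂) (b₁ : Y₁) (b₂ : Y₂) :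
    lawXY (productSource P₁ P₂) ((a₁, a₂), (b₁, b₂)) =
      lawXY P₁ (a₁, b₁) * lawXY P₂ (a₂, b₂) := by
  rw [← bind_map_apply (lawXY P₁) (lawXY P₂)
    (e := fun u v => ((u.1, v.1), (u.2, v.2))) (fun u u' v v' h => by
      simp only [Prod.mk.injEq] at h
      exact ⟨Prod.ext h.1.1 h.2.1, Prod.ext h.1.2 h.2.2⟩)]
  simp only [lawXY, productSource, PMF.map_bind, PMF.bind_map, PMF.map_comp]
  rfl

theorem lawXZ_productSource_apply (P₁ : PMF (X₁ × Y₁ × Z₁)) (P₂ : PMF (X₂ × Y₂ × Z₂))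
    (a₁ : X₁) (a₂ : X₂) (b₁ : Z₁) (b₂ : Z₂) :
    lawXZ (productSource P₁ P₂) ((a₁, a₂), (b₁, b₂)) =
      lawXZ P₁ (a₁, b₁) * lawXZ P₂ (a₂, b₂) := by
  rw [← bind_map_apply (lawXZ P₁) (lawXZ P₂)
    (e := fun u v => ((u.1, v.1), (u.2, v.2))) (fun u u' v v' h => by
      simp only [Prod.mk.injEq] at h
      exact ⟨Prod.ext h.1.1 h.2.1, Prod.ext h.1.2 h.2.2⟩)]
  simp only [lawXZ, productSource, PMF.map_bind, PMF.bind_map, PMF.map_comp]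
  rfl

theorem productDistortion_exact {V₁ V₂ : Type*} {d₁ : X₁ → V₁ → ℝ≥0} {d₂ : X₂ → V₂ → ℝ≥0}
    (h₁ : ZeroMeansExact d₁) (h₂ : ZeroMeansExact d₂) :
    (∀ x, ∃ v, ∀ i, productDistortion d₁ d₂ i x v = 0) ∧
    ∀ x x' v, (∀ i, productDistortion d₁ d₂ i x v = 0) →
      (∀ i, productDistortion d₁ d₂ i x' v = 0) → x = x' := by
  simp only [Fin.forall_fin_two, productDistortion, Matrix.cons_val_zero, Matrix.cons_val_one]
  refine ⟨fun x => ?_, fun x x' v h h' => ?_⟩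
  · obtain ⟨v₁, hv₁⟩ := h₁.1 x.1
    obtain ⟨v₂, hv₂⟩ := h₂.1 x.2
    exact ⟨(v₁, v₂), hv₁, hv₂⟩
  · exact Prod.ext (h₁.2 _ _ _ h.1 h'.1) (h₂.2 _ _ _ h.2 h'.2)

theorem productRates_zero_eq_Ici [Fintype X₁] [Fintype Y₁] [Fintype Z₁] [Fintype X₂] [Fintype Y₂]
    [Fintype Z₂] {Xh₁ Xh₂ Xt₁ Xt₂ : Type*} [Finite Xh₁] [Finite Xh₂] [Finite Xt₁] [Finite Xt₂]
    (P₁ : PMF (X₁ × Y₁ × Z₁)) (P₂ : PMF (X₂ × Y₂ × Z₂))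
    {dh₁ : X₁ → Xh₁ → ℝ≥0} {dh₂ : X₂ → Xh₂ → ℝ≥0}
    {dt₁ : X₁ → Xt₁ → ℝ≥0} {dt₂ : X₂ → Xt₂ → ℝ≥0}
    (hh₁ : ZeroMeansExact dh₁) (hh₂ : ZeroMeansExact dh₂)
    (ht₁ : ZeroMeansExact dt₁) (ht₂ : ZeroMeansExact dt₂) :
    productRates P₁ P₂ dh₁ dh₂ dt₁ dt₂ 0 0 =
      Set.Ici (max (condEntropy (lawXY P₁) + condEntropy (lawXY P₂))
        (condEntropy (lawXZ P₁) + condEntropy (lawXZ P₂))) := by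
  obtain ⟨hh, hh'⟩ := productDistortion_exact hh₁ hh₂
  obtain ⟨ht, ht'⟩ := productDistortion_exact ht₁ ht₂
  rw [productRates, achievableRates_zero_eq_Ici _ _ _ hh hh' ht ht',
    condEntropy_prod _ _ _ (lawXY_productSource_apply P₁ P₂),
    condEntropy_prod _ _ _ (lawXZ_productSource_apply P₁ P₂)]

end Product

/-! ### A binary example -/

section Example

/-- A fair bit `X` with side information `Y = X ∧ N` and `Z = X ∧ N ∧ N'`, where `N` and `N'` are
independent fair bits: each step of the chain passes the last bit through a Z-channel. -/
noncomputable def bitCascade : PMF (Bool × Bool × Bool) :=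
  (PMF.uniformOfFintype (Bool × Bool × Bool)).map fun u =>
    (u.1, u.1 && u.2.1, u.1 && u.2.1 && u.2.2)

theorem map_bitCascade_toReal {A : Type*} [DecidableEq A] (f : Bool × Bool × Bool → A) (a : A) :
    (bitCascade.map f a).toReal = (1 / 8) * ∑ u : Bool × Bool × Bool,
      if f (u.1, u.1 && u.2.1, u.1 && u.2.1 && u.2.2) = a then 1 else 0 := by
  rw [bitCascade, PMF.map_comp, map_toReal, Finset.mul_sum]
  refine Finset.sum_congr rfl fun u _ => ?_
  by_cases h : f (u.1, u.1 && u.2.1, u.1 && u.2.1 && u.2.2) = a <;> simp [h]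

theorem isMarkovChain_bitCascade : IsMarkovChain bitCascade := by
  intro a b c
  rw [← ENNReal.toReal_eq_toReal_iff' (ENNReal.mul_ne_top (PMF.apply_ne_top _ _)
    (PMF.apply_ne_top _ _)) (ENNReal.mul_ne_top (PMF.apply_ne_top _ _) (PMF.apply_ne_top _ _)),
    ENNReal.toReal_mul, ENNReal.toReal_mul]
  have h := map_bitCascade_toReal id (a, b, c)
  rw [PMF.map_id] at h
  rw [h]
  simp only [map_bitCascade_toReal, Fintype.sum_prod_type, Fintype.sum_bool]
  cases a <;> cases b <;> cases c <;> simp <;> norm_num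

theorem condEntropy_bitCascade_lt :
    condEntropy (lawXY bitCascade) < condEntropy (lawXZ bitCascade) := by
  have h₁ : condEntropy (lawXY bitCascade) =
      (1 / 4) * Real.log 3 + (1 / 2) * -Real.log (2 / 3) := by
    simp only [condEntropy_eq_sum, condProb, lawXY, PMF.map_comp, map_bitCascade_toReal,
      Fintype.sum_prod_type, Fintype.sum_bool]
    simp
    norm_num
    rw [Real.log_div (by norm_num) (by norm_num), Real.log_one]
    ring
  have h₂ : condEntropy (lawXZ bitCascade) =
      (3 / 8) * -Real.log (3 / 7) + (1 / 2) * -Real.log (4 / 7) := by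
    simp only [condEntropy_eq_sum, condProb, lawXZ, PMF.map_comp, map_bitCascade_toReal,
      Fintype.sum_prod_type, Fintype.sum_bool]
    simp
    norm_num
  -- The difference is `(1 / 8) * log (7 ^ 7 / (2 ^ 4 * 3 ^ 9))`.
  have h4 : Real.log 4 = 2 * Real.log 2 := by
    rw [show (4 : ℝ) = 2 ^ 2 by norm_num, Real.log_pow]
    norm_num
  have h := Real.log_lt_log (show (0 : ℝ) < 2 ^ 4 * 3 ^ 9 by norm_num)
    (show (2 : ℝ) ^ 4 * 3 ^ 9 < 7 ^ 7 by norm_num)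
  rw [Real.log_mul (by norm_num) (by norm_num), Real.log_pow, Real.log_pow, Real.log_pow] at h
  rw [h₁, h₂, Real.log_div (by norm_num) (by norm_num), Real.log_div (by norm_num) (by norm_num),
    Real.log_div (by norm_num) (by norm_num), h4]
  push_cast at h
  linarith

end Example

end SideInfo

/-! ### The rate at distortion zero and its gap to separate coding -/

theorem mainTheorem3 :
    (∀ {X₁ Y₁ Z₁ X₂ Y₂ Z₂ Xh₁ Xh₂ Xt₁ Xt₂ : Type*}
      [Fintype X₁] [Fintype Y₁] [Fintype Z₁] [Fintype X₂] [Fintype Y₂] [Fintype Z₂]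
      [Fintype Xh₁] [Fintype Xh₂] [Fintype Xt₁] [Fintype Xt₂]
      (P₁ : PMF (X₁ × Y₁ × Z₁)) (P₂ : PMF (X₂ × Y₂ × Z₂))
      (dh₁ : X₁ → Xh₁ → ℝ≥0) (dh₂ : X₂ → Xh₂ → ℝ≥0)
      (dt₁ : X₁ → Xt₁ → ℝ≥0) (dt₂ : X₂ → Xt₂ → ℝ≥0),
      SideInfo.ZeroMeansExact dh₁ → SideInfo.ZeroMeansExact dh₂ →
      SideInfo.ZeroMeansExact dt₁ → SideInfo.ZeroMeansExact dt₂ →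
      SideInfo.MismatchedDegraded P₁ P₂ →
      (SideInfo.productRates P₁ P₂ dh₁ dh₂ dt₁ dt₂ 0 0).Nonempty ∧
      BddBelow (SideInfo.productRates P₁ P₂ dh₁ dh₂ dt₁ dt₂ 0 0) ∧
      SideInfo.productRD P₁ P₂ dh₁ dh₂ dt₁ dt₂ 0 0 =
        max (SideInfo.condEntropy (SideInfo.lawXY P₁) + SideInfo.condEntropy (SideInfo.lawXY P₂))
          (SideInfo.condEntropy (SideInfo.lawXZ P₁) + SideInfo.condEntropy (SideInfo.lawXZ P₂))) ∧
    (∃ P₁ P₂ : PMF (Bool × Bool × Bool), SideInfo.MismatchedDegraded P₁ P₂ ∧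
      max (SideInfo.condEntropy (SideInfo.lawXY P₁) + SideInfo.condEntropy (SideInfo.lawXY P₂))
          (SideInfo.condEntropy (SideInfo.lawXZ P₁) + SideInfo.condEntropy (SideInfo.lawXZ P₂)) <
        max (SideInfo.condEntropy (SideInfo.lawXY P₁)) (SideInfo.condEntropy (SideInfo.lawXZ P₁)) +
        max (SideInfo.condEntropy (SideInfo.lawXY P₂)) (SideInfo.condEntropy (SideInfo.lawXZ P₂)) ∧
      ∀ {Xh₁ Xh₂ Xt₁ Xt₂ : Type*}
        [Fintype Xh₁] [Fintype Xh₂] [Fintype Xt₁] [Fintype Xt₂]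
        (dh₁ : Bool → Xh₁ → ℝ≥0) (dh₂ : Bool → Xh₂ → ℝ≥0)
        (dt₁ : Bool → Xt₁ → ℝ≥0) (dt₂ : Bool → Xt₂ → ℝ≥0),
        SideInfo.ZeroMeansExact dh₁ → SideInfo.ZeroMeansExact dh₂ →
        SideInfo.ZeroMeansExact dt₁ → SideInfo.ZeroMeansExact dt₂ →
        SideInfo.productRD P₁ P₂ dh₁ dh₂ dt₁ dt₂ 0 0 <
          SideInfo.componentRD P₁ dh₁ dt₁ 0 0 + SideInfo.componentRD P₂ dh₂ dt₂ 0 0) := by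
  refine ⟨?_, SideInfo.bitCascade, SideInfo.lawXZY SideInfo.bitCascade, ?_⟩
  · intro X₁ Y₁ Z₁ X₂ Y₂ Z₂ Xh₁ Xh₂ Xt₁ Xt₂ _ _ _ _ _ _ _ _ _ _ P₁ P₂ dh₁ dh₂ dt₁ dt₂
      hh₁ hh₂ ht₁ ht₂ _
    have h := SideInfo.productRates_zero_eq_Ici P₁ P₂ hh₁ hh₂ ht₁ ht₂
    exact ⟨h ▸ Set.nonempty_Ici, h ▸ bddBelow_Ici, (congrArg sInf h).trans csInf_Ici⟩
  · have hswap : SideInfo.lawXZY (SideInfo.lawXZY SideInfo.bitCascade) = SideInfo.bitCascade := by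
      simp only [SideInfo.lawXZY, PMF.map_comp]
      exact PMF.map_id _
    have hXY : SideInfo.lawXY (SideInfo.lawXZY SideInfo.bitCascade) =
        SideInfo.lawXZ SideInfo.bitCascade := by
      simp only [SideInfo.lawXY, SideInfo.lawXZ, SideInfo.lawXZY, PMF.map_comp]
      rfl
    have hXZ : SideInfo.lawXZ (SideInfo.lawXZY SideInfo.bitCascade) =
        SideInfo.lawXY SideInfo.bitCascade := by
      simp only [SideInfo.lawXY, SideInfo.lawXZ, SideInfo.lawXZY, PMF.map_comp]
      rfl
    have hlt := SideInfo.condEntropy_bitCascade_lt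
    have hgap : max (SideInfo.condEntropy (SideInfo.lawXY SideInfo.bitCascade) +
          SideInfo.condEntropy (SideInfo.lawXY (SideInfo.lawXZY SideInfo.bitCascade)))
        (SideInfo.condEntropy (SideInfo.lawXZ SideInfo.bitCascade) +
          SideInfo.condEntropy (SideInfo.lawXZ (SideInfo.lawXZY SideInfo.bitCascade))) <
        max (SideInfo.condEntropy (SideInfo.lawXY SideInfo.bitCascade))
          (SideInfo.condEntropy (SideInfo.lawXZ SideInfo.bitCascade)) +
        max (SideInfo.condEntropy (SideInfo.lawXY (SideInfo.lawXZY SideInfo.bitCascade)))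
          (SideInfo.condEntropy (SideInfo.lawXZ (SideInfo.lawXZY SideInfo.bitCascade))) := by
      rw [hXY, hXZ, max_eq_right hlt.le, max_eq_left hlt.le]
      exact max_lt (by linarith) (by linarith)
    refine ⟨⟨SideInfo.isMarkovChain_bitCascade, ?_⟩, hgap, ?_⟩
    · rw [hswap]
      exact SideInfo.isMarkovChain_bitCascade
    · intro Xh₁ Xh₂ Xt₁ Xt₂ _ _ _ _ dh₁ dh₂ dt₁ dt₂ hh₁ hh₂ ht₁ ht₂
      rw [SideInfo.componentRD_zero_eq _ _ _ hh₁ ht₁, SideInfo.componentRD_zero_eq _ _ _ hh₂ ht₂]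
      exact ((congrArg sInf (SideInfo.productRates_zero_eq_Ici _ _ hh₁ hh₂ ht₁ ht₂)).trans
        csInf_Ici).trans_lt hgap
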